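/- For $\nu,z\in\mathbb C$ let $I_\nu(z)=\sum_{m\ge 0}\frac{(z/2)^{2m+\nu}}{m!\,\Gamma(m+\nu+1)}$ be the modified Bessel function of the first kind and let ${}_1F_1(a;b;z)=\sum_{k\ge 0}\frac{(a)_k}{(b)_k}\frac{z^k}{k!}$ be the confluent hypergeometric function; all complex powers are principal. Let $\alpha,\beta,\gamma,\lambda,s\in\mathbb C$ with $\operatorname{Re}(\alpha),\operatorname{Re}(\beta),\operatorname{Re}(\gamma),\operatorname{Re}(\lambda)>0$ and $\operatorname{Re}(s)>1$. Then the integral $$\Upsilon(\alpha,\beta,\gamma,\lambda,s):=\int_0^\infty \exp(-\alpha y^2-\beta y)\,I_\lambda(\gamma y)\,y^{s-1}\,dy$$ converges absolutely, and $$\Upsilon(\alpha,\beta,\gamma,\lambda,s)=\sum_{n=0}^\infty \frac{(-1)^{n}\gamma^{\lambda}(i\gamma)^{2n}\,2^{-\lambda-2n-1}\,\alpha^{-\frac{\lambda}{2}-n-\frac s2-\frac12}}{n!\,\Gamma(n+\lambda+1)}\Big[\sqrt{\alpha}\,\Gamma\big(\tfrac{2n+s+\lambda}{2}\big)\,{}_1F_1\big(\tfrac{2n+s+\lambda}{2};\tfrac12;\tfrac{\beta^2}{4\alpha}\big)-\beta\,\Gamma\big(\tfrac{2n+s+\lambda+1}{2}\big)\,{}_1F_1\big(\tfrac{2n+s+\lambda+1}{2};\tfrac32;\tfrac{\beta^2}{4\alpha}\big)\Big],$$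 where the series converges absolutely. -/

import Mathlib

open MeasureTheory

/-- The modified Bessel function of the first kind
`I_ν(z) = ∑_{m ≥ 0} (z/2)^(2m+ν) / (m! Γ(m+ν+1))`, with principal powers. -/
noncomputable def besselI (ν z : ℂ) : ℂ :=
  ∑' m : ℕ, (z / 2) ^ (2 * (m : ℂ) + ν) / ((m.factorial : ℂ) * Complex.Gamma (m + ν + 1))

/-- In the right half plane this is `I_ν(z) = i^(-ν) J_ν(i z)`, the Bessel function `J_ν` being
written as its power series. -/
theorem besselI_eq (ν z : ℂ) (hz : 0 < z.re) :
    besselI ν z = Complex.I ^ (-ν) * ∑' m : ℕ,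
      (-1) ^ m / ((m.factorial : ℂ) * Complex.Gamma (m + ν + 1)) *
        (Complex.I * z / 2) ^ (2 * (m : ℂ) + ν) := by
  have hz0 : z / 2 ≠ 0 := by
    intro h
    have h2 : z = 0 := by simpa using h
    simp [h2] at hz
  have hre : 0 < (z / 2).re := by simpa using hz
  have harg := abs_lt.1 (Complex.abs_arg_lt_pi_div_two_iff.2 (Or.inl hre))
  unfold besselI
  rw [← tsum_mul_left]
  refine tsum_congr fun m => ?_
  have h1 : (Complex.I * z / 2) ^ (2 * (m : ℂ) + ν) =
      Complex.I ^ (2 * (m : ℂ) + ν) * (z / 2) ^ (2 * (m : ℂ) + ν) := by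
    have hlog : Complex.log (Complex.I * (z / 2)) = Complex.log Complex.I + Complex.log (z / 2) := by
      refine Complex.log_mul Complex.I_ne_zero hz0 ?_
      rw [Complex.arg_I]
      constructor <;> linarith [Real.pi_pos, harg.1, harg.2]
    rw [mul_div_assoc, Complex.cpow_def_of_ne_zero (mul_ne_zero Complex.I_ne_zero hz0), hlog,
      Complex.cpow_def_of_ne_zero Complex.I_ne_zero, Complex.cpow_def_of_ne_zero hz0,
      ← Complex.exp_add, add_mul]
  have h2 : Complex.I ^ (2 * (m : ℂ) + ν) = (-1) ^ m * Complex.I ^ ν := by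
    rw [Complex.cpow_add _ _ Complex.I_ne_zero]
    have : (2 * (m : ℂ)) = ((2 * m : ℕ) : ℂ) := by push_cast; ring
    rw [this, Complex.cpow_natCast, pow_mul, Complex.I_sq]
  have h3 : Complex.I ^ ν ≠ 0 := by simp [Complex.cpow_eq_zero_iff]
  have h4 : ((-1 : ℂ) ^ m) * (-1) ^ m = 1 := by rw [← mul_pow]; simp
  rw [h1, h2, Complex.cpow_neg]
  field_simp
  linear_combination -((z / 2) ^ (2 * (m : ℂ) + ν) / ((m.factorial : ℂ) *
    Complex.Gamma (m + ν + 1))) * h4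

/-- Kummer's confluent hypergeometric function `₁F₁(a; b; z)`: Mathlib's regularized
hypergeometric function with one upper and one lower parameter, with the factor `1 / Γ(b)`
removed. -/
noncomputable def kummerF (a b z : ℂ) : ℂ :=
  Complex.Gamma b * Complex.regularizedHGFun {a} {b} z

/-- `₁F₁(a; b; z) = ∑_k (a)_k / (b)_k * z^k / k!` with rising Pochhammer symbols. -/
theorem kummerF_eq_tsum (a b z : ℂ) (hb : ∀ k : ℕ, b ≠ -k) :
    kummerF a b z = ∑' k : ℕ, (ascPochhammer ℂ k).eval a / (ascPochhammer ℂ k).eval b *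
      (z ^ k / (k.factorial : ℂ)) := by
  have hcoeff : ∀ k : ℕ, Complex.Gamma (b + k) =
      Complex.Gamma b * (ascPochhammer ℂ k).eval b := by
    intro k
    rw [← Complex.Gamma_add_nat_div_Gamma_eq b hb,
      mul_div_cancel₀ _ (Complex.Gamma_ne_zero hb)]
  unfold kummerF Complex.regularizedHGFun FormalMultilinearSeries.sum
  rw [← tsum_mul_left]
  refine tsum_congr fun k => ?_
  have hb0 := Complex.Gamma_ne_zero hb
  simp only [Complex.regularizedHGFunSeries, FormalMultilinearSeries.ofScalars_apply_eq,
    Complex.regularizedHGFunCoeff, Multiset.map_singleton, Multiset.prod_singleton, hcoeff,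
    smul_eq_mul]
  field_simp

/-- `Υ(α, β, γ, lam, s) = ∫_0^∞ exp(-α y² - β y) I_lam(γ y) y^(s-1) dy`. -/
noncomputable def Upsilon (α β γ lam s : ℂ) : ℂ :=
  ∫ y in Set.Ioi (0 : ℝ), Complex.exp (-α * (y : ℂ) ^ 2 - β * y) * besselI lam (γ * y) *
    (y : ℂ) ^ (s - 1)

/-! Inserting the power series of `I_λ` and integrating term by term leaves, up to constants,
integrals of `y^(σ-1) exp(-αy² - βy)` with `σ = 2n + s + λ`. Expanding `exp(-βy)` reduces these to
the Gaussian moments `½ α^(-σ/2) Γ(σ/2)`; the even and odd powers of `β` then sum to the two Kummer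
functions.

Both interchanges are dominated. The exponential series is bounded by that of `exp(|β|y)`, and the
Bessel series by a constant times `y^(Re λ)` times the series of `cosh(|γ|y)`. The Gaussian absorbs
either growth, which also gives absolute convergence of the integral. -/

/-- Dominated convergence for series, including integrability of the sum. -/
theorem integrable_and_hasSum_integral_of_dominated {X : Type*} [MeasurableSpace X] {μ : Measure X}
    {F : ℕ → X → ℂ} {f : X → ℂ} (bound : ℕ → X → ℝ) (B : X → ℝ)
    (hF : ∀ n, AEStronglyMeasurable (F n) μ) (hb : ∀ n, ∀ᵐ x ∂μ, ‖F n x‖ ≤ bound n x)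
    (hB : ∀ᵐ x ∂μ, HasSum (fun n => bound n x) (B x)) (hBi : Integrable B μ)
    (hf : ∀ᵐ x ∂μ, HasSum (fun n => F n x) (f x)) :
    Integrable f μ ∧ HasSum (fun n => ∫ x, F n x ∂μ) (∫ x, f x ∂μ) := by
  refine ⟨hBi.mono' ?_ ?_, hasSum_integral_of_dominated_convergence bound hF hb
    (hB.mono fun x hx => hx.summable) (hBi.congr (hB.mono fun x hx => hx.tsum_eq.symm)) hf⟩
  · refine aestronglyMeasurable_of_tendsto_ae Filter.atTop
      (f := fun n x => ∑ i ∈ Finset.range n, F i x) (fun n => ?_)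
      (hf.mono fun x hx => hx.tendsto_sum_nat)
    exact Finset.aestronglyMeasurable_fun_sum _ fun i _ => hF i
  · filter_upwards [ae_all_iff.2 hb, hB, hf] with x h1 h2 h3
    rw [← h3.tsum_eq]
    exact tsum_of_norm_bounded h2 h1

/-! ### Gaussian moments -/

/-- Completing the square, half of the Gaussian absorbs `exp(by)` at the cost of the constant
`exp(b²/(2a))`. -/
theorem integrableOn_rpow_mul_exp_quadratic {a p : ℝ} (ha : 0 < a) (hp : -1 < p) (b : ℝ) :
    IntegrableOn (fun y : ℝ => y ^ p * Real.exp (-a * y ^ 2 + b * y)) (Set.Ioi 0) := by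
  have h := (integrableOn_rpow_mul_exp_neg_mul_sq (half_pos ha) hp).const_mul
    (Real.exp (b ^ 2 / (2 * a)))
  refine h.mono' ?_ ?_
  · exact (by fun_prop : Measurable fun y : ℝ => y ^ p * Real.exp (-a * y ^ 2 + b * y))
      |>.aestronglyMeasurable
  · filter_upwards [ae_restrict_mem measurableSet_Ioi] with y hy
    have hy : 0 < y := hy
    rw [Real.norm_of_nonneg (by positivity), mul_left_comm, ← Real.exp_add]
    refine mul_le_mul_of_nonneg_left (Real.exp_le_exp.2 ?_) (by positivity)
    have : b ^ 2 / (2 * a) + -(a / 2) * y ^ 2 - (-a * y ^ 2 + b * y)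
        = (a * y - b) ^ 2 / (2 * a) := by field_simp; ring
    have : 0 ≤ (a * y - b) ^ 2 / (2 * a) := by positivity
    linarith

theorem norm_cpow_mul_cexp_quadratic {y : ℝ} (hy : 0 < y) (σ α β : ℂ) :
    ‖(y : ℂ) ^ σ * Complex.exp (-α * (y : ℂ) ^ 2 + β * y)‖ =
      y ^ σ.re * Real.exp (-α.re * y ^ 2 + β.re * y) := by
  rw [norm_mul, Complex.norm_cpow_eq_rpow_re_of_pos hy, Complex.norm_exp]
  congr 2
  rw [← Complex.ofReal_pow]
  simp [-Complex.ofReal_pow]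

theorem integrableOn_cpow_mul_cexp_quadratic {σ α : ℂ} (hα : 0 < α.re) (hσ : -1 < σ.re) (β : ℂ) :
    IntegrableOn (fun y : ℝ => (y : ℂ) ^ σ * Complex.exp (-α * (y : ℂ) ^ 2 + β * y))
      (Set.Ioi 0) := by
  refine (integrableOn_rpow_mul_exp_quadratic hα hσ β.re).mono' ?_ ?_
  · exact (by fun_prop : Measurable fun y : ℝ => (y : ℂ) ^ σ *
      Complex.exp (-α * (y : ℂ) ^ 2 + β * y)).aestronglyMeasurable
  · filter_upwards [ae_restrict_mem measurableSet_Ioi] with y hy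
    rw [norm_cpow_mul_cexp_quadratic hy]

theorem integrableOn_cpow_mul_cexp_neg_mul_sq {σ α : ℂ} (hα : 0 < α.re) (hσ : -1 < σ.re) :
    IntegrableOn (fun y : ℝ => (y : ℂ) ^ σ * Complex.exp (-α * (y : ℂ) ^ 2)) (Set.Ioi 0) := by
  simpa using integrableOn_cpow_mul_cexp_quadratic hα hσ 0

theorem differentiableAt_integral_cpow_mul_cexp_neg_mul_sq {σ α : ℂ} (hα : 0 < α.re)
    (hσ : -1 < σ.re) :
    DifferentiableAt ℂ (fun z : ℂ => ∫ y in Set.Ioi (0 : ℝ),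
      (y : ℂ) ^ σ * Complex.exp (-z * (y : ℂ) ^ 2)) α := by
  -- Staying to the right of `Re α / 2` gives one Gaussian majorant for all nearby `z`.
  have hs : {z : ℂ | α.re / 2 < z.re} ∈ nhds α :=
    (isOpen_lt continuous_const Complex.continuous_re).mem_nhds (by simp; linarith)
  refine (hasDerivAt_integral_of_dominated_loc_of_deriv_le (𝕜 := ℂ) hs
    (F := fun z (y : ℝ) => (y : ℂ) ^ σ * Complex.exp (-z * (y : ℂ) ^ 2))
    (F' := fun z (y : ℝ) => (y : ℂ) ^ σ * (Complex.exp (-z * (y : ℂ) ^ 2) * -(y : ℂ) ^ 2))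
    (bound := fun y : ℝ => y ^ (σ.re + 2) * Real.exp (-(α.re / 2) * y ^ 2))
    (Filter.Eventually.of_forall fun z => ?_) (integrableOn_cpow_mul_cexp_neg_mul_sq hα hσ)
    ?_ ?_ ?_ ?_).2.differentiableAt
  · exact (by fun_prop : Measurable fun y : ℝ => (y : ℂ) ^ σ *
      Complex.exp (-z * (y : ℂ) ^ 2)).aestronglyMeasurable
  · exact (by fun_prop : Measurable fun y : ℝ => (y : ℂ) ^ σ *
      (Complex.exp (-α * (y : ℂ) ^ 2) * -(y : ℂ) ^ 2)).aestronglyMeasurable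
  · filter_upwards [ae_restrict_mem measurableSet_Ioi] with y hy z hz
    have hy : 0 < y := hy
    have hz : α.re / 2 < z.re := hz
    have h := norm_cpow_mul_cexp_quadratic hy σ z 0
    simp only [zero_mul, add_zero, Complex.zero_re] at h
    rw [← mul_assoc, norm_mul, h, norm_neg, norm_pow, Complex.norm_of_nonneg hy.le,
      Real.rpow_add hy, Real.rpow_two]
    have : Real.exp (-z.re * y ^ 2) ≤ Real.exp (-(α.re / 2) * y ^ 2) := by gcongr
    calc y ^ σ.re * Real.exp (-z.re * y ^ 2) * y ^ 2
        = y ^ σ.re * y ^ 2 * Real.exp (-z.re * y ^ 2) := by ring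
      _ ≤ _ := by gcongr
  · exact integrableOn_rpow_mul_exp_neg_mul_sq (half_pos hα) (by linarith)
  · refine Filter.Eventually.of_forall fun y z _ => ?_
    have h1 : HasDerivAt (fun w : ℂ => -w * (y : ℂ) ^ 2) (-(y : ℂ) ^ 2) z := by
      simpa using ((hasDerivAt_id z).neg.mul_const ((y : ℂ) ^ 2))
    exact h1.cexp.const_mul _

/-- The substitution `t = y²` turns the moment into Euler's integral for `Γ(σ/2)`. -/
theorem integral_cpow_mul_cexp_neg_ofReal_mul_sq {σ : ℂ} {r : ℝ} (hr : 0 < r) (hσ : 0 < σ.re) :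
    ∫ y in Set.Ioi (0 : ℝ), (y : ℂ) ^ (σ - 1) * Complex.exp (-(r : ℂ) * (y : ℂ) ^ 2) =
      1 / 2 * (r : ℂ) ^ (-σ / 2) * Complex.Gamma (σ / 2) := by
  have h := mellin_comp_rpow (fun t : ℝ => Complex.exp (-((r : ℂ) * t))) σ 2
  have h2 : mellin (fun t : ℝ => Complex.exp (-((r : ℂ) * t))) (σ / 2) =
      (r : ℂ) ^ (-σ / 2) * Complex.Gamma (σ / 2) := by
    have := Complex.integral_cpow_mul_exp_neg_mul_Ioi (a := σ / 2) (r := r) (by simpa using hσ) hr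
    rw [mellin]
    simp only [smul_eq_mul]
    rw [this, one_div, Complex.inv_cpow_ofReal_nonneg hr.le, neg_div, Complex.cpow_neg]
  simp only [Complex.ofReal_ofNat, h2] at h
  simp only [mellin, smul_eq_mul, Real.rpow_two, Complex.ofReal_pow] at h
  simp only [neg_mul]
  rw [h]
  simp [mul_assoc]

/-- Both sides are holomorphic in `α` on the right half plane and agree for real `α > 0`, so the
identity theorem applies. -/
theorem integral_cpow_mul_cexp_neg_mul_sq {σ α : ℂ} (hα : 0 < α.re) (hσ : 0 < σ.re) :
    ∫ y in Set.Ioi (0 : ℝ), (y : ℂ) ^ (σ - 1) * Complex.exp (-α * (y : ℂ) ^ 2) =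
      1 / 2 * α ^ (-σ / 2) * Complex.Gamma (σ / 2) := by
  set U : Set ℂ := {z | 0 < z.re}
  have hU : IsOpen U := isOpen_lt continuous_const Complex.continuous_re
  have hf : AnalyticOnNhd ℂ (fun z : ℂ => ∫ y in Set.Ioi (0 : ℝ),
      (y : ℂ) ^ (σ - 1) * Complex.exp (-z * (y : ℂ) ^ 2)) U :=
    DifferentiableOn.analyticOnNhd (fun z hz =>
      (differentiableAt_integral_cpow_mul_cexp_neg_mul_sq hz
        (by simpa using hσ)).differentiableWithinAt) hU
  have hg : AnalyticOnNhd ℂ (fun z : ℂ => 1 / 2 * z ^ (-σ / 2) * Complex.Gamma (σ / 2)) U :=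
    DifferentiableOn.analyticOnNhd (fun z hz =>
      (((differentiableAt_id.cpow_const (Or.inl hz)).const_mul _).mul_const
        _).differentiableWithinAt) hU
  refine hf.eqOn_of_preconnected_of_frequently_eq hg
    (convex_halfSpace_re_gt 0).isPreconnected (z₀ := 1) (by simp [U]) ?_ hα
  -- Reals `r > 1` tending to `1` supply the accumulating points of agreement.
  have ht : Filter.Tendsto (fun r : ℝ => (r : ℂ)) (nhdsWithin 1 (Set.Ioi 1))
      (nhdsWithin 1 {1}ᶜ) := by
    refine tendsto_nhdsWithin_iff.2 ⟨?_, ?_⟩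
    · exact (Complex.continuous_ofReal.tendsto' 1 1 (by simp)).mono_left nhdsWithin_le_nhds
    · filter_upwards [self_mem_nhdsWithin] with r hr
      have : r ≠ 1 := ne_of_gt hr
      simpa using this
  refine ht.frequently (Filter.Eventually.frequently ?_)
  filter_upwards [self_mem_nhdsWithin] with r hr
  exact integral_cpow_mul_cexp_neg_ofReal_mul_sq (zero_lt_one.trans hr) hσ

/-! ### Gamma quotients, Pochhammer symbols and Kummer functions -/

theorem Complex.ne_neg_natCast_of_re_pos {z : ℂ} (hz : 0 < z.re) (k : ℕ) : z ≠ -k := by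
  rintro rfl
  simp only [Complex.neg_re, Complex.natCast_re] at hz
  linarith [k.cast_nonneg (α := ℝ)]

theorem Complex.Gamma_add_natCast_of_re_pos {z : ℂ} (hz : 0 < z.re) (n : ℕ) :
    Complex.Gamma (z + n) = Complex.Gamma z * (ascPochhammer ℂ n).eval z := by
  have h := Complex.ne_neg_natCast_of_re_pos hz
  rw [← Complex.Gamma_add_nat_div_Gamma_eq z h, mul_div_cancel₀ _ (Complex.Gamma_ne_zero h)]

theorem ascPochhammer_eval_ne_zero_of_re_pos {z : ℂ} (hz : 0 < z.re) (n : ℕ) :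
    (ascPochhammer ℂ n).eval z ≠ 0 := by
  intro h
  refine Complex.Gamma_ne_zero_of_re_pos (s := z + n) ?_ ?_
  · simp only [Complex.add_re, Complex.natCast_re]; positivity
  · rw [Complex.Gamma_add_natCast_of_re_pos hz, h, mul_zero]

/-- This and its odd analogue produce the lower parameters `1/2` and `3/2` of the Kummer functions.
-/
theorem factorial_two_mul_eq_ascPochhammer_half (j : ℕ) :
    ((2 * j).factorial : ℂ) = 4 ^ j * j.factorial * (ascPochhammer ℂ j).eval (1 / 2) := by
  induction j with
  | zero => simp
  | succ j ih =>
    rw [mul_add, mul_one, Nat.factorial_succ, Nat.factorial_succ, Nat.factorial_succ,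
      ascPochhammer_succ_eval]
    push_cast
    rw [ih]
    ring

theorem factorial_two_mul_add_one_eq_ascPochhammer_three_halves (j : ℕ) :
    ((2 * j + 1).factorial : ℂ) = 4 ^ j * j.factorial * (ascPochhammer ℂ j).eval (3 / 2) := by
  induction j with
  | zero => simp
  | succ j ih =>
    rw [mul_add, mul_one, Nat.factorial_succ, Nat.factorial_succ, Nat.factorial_succ j,
      ascPochhammer_succ_eval]
    push_cast
    rw [ih]
    ring

theorem hasSum_integral_cpow_mul_cexp_quadratic {σ α : ℂ} (hα : 0 < α.re) (hσ : 0 < σ.re)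
    (β : ℂ) :
    HasSum (fun k : ℕ => (-β) ^ k / (k.factorial : ℂ) *
        (1 / 2 * α ^ (-(σ + k) / 2) * Complex.Gamma ((σ + k) / 2)))
      (∫ y in Set.Ioi (0 : ℝ), (y : ℂ) ^ (σ - 1) *
        Complex.exp (-α * (y : ℂ) ^ 2 + -β * y)) := by
  have hpt : ∀ k : ℕ, ∀ y : ℝ, 0 < y → (y : ℂ) ^ (σ - 1) * Complex.exp (-α * (y : ℂ) ^ 2) *
      ((-β * y) ^ k / (k.factorial : ℂ)) = (-β) ^ k / (k.factorial : ℂ) *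
        ((y : ℂ) ^ (σ + k - 1) * Complex.exp (-α * (y : ℂ) ^ 2)) := by
    intro k y hy
    have : (y : ℂ) ^ (σ + k - 1) = (y : ℂ) ^ (σ - 1) * (y : ℂ) ^ k := by
      rw [← Complex.cpow_natCast, ← Complex.cpow_add _ _ (by exact_mod_cast hy.ne')]
      ring_nf
    rw [this, mul_pow]
    ring
  have key := (integrable_and_hasSum_integral_of_dominated (μ := volume.restrict (Set.Ioi (0 : ℝ)))
    (F := fun k y => (y : ℂ) ^ (σ - 1) * Complex.exp (-α * (y : ℂ) ^ 2) *
      ((-β * y) ^ k / (k.factorial : ℂ)))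
    (f := fun y => (y : ℂ) ^ (σ - 1) * Complex.exp (-α * (y : ℂ) ^ 2 + -β * y))
    (fun k y => y ^ (σ.re - 1) * Real.exp (-α.re * y ^ 2) *
      ((‖β‖ * y) ^ k / (k.factorial : ℝ)))
    (fun y => y ^ (σ.re - 1) * Real.exp (-α.re * y ^ 2 + ‖β‖ * y)) (fun k => ?_) (fun k => ?_)
    (Filter.Eventually.of_forall fun y => ?_)
    (integrableOn_rpow_mul_exp_quadratic hα (by linarith) _)
    (Filter.Eventually.of_forall fun y => ?_)).2
  · convert! key using 2 with k
    rw [← integral_cpow_mul_cexp_neg_mul_sq hα (σ := σ + k)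
      (by simp only [Complex.add_re, Complex.natCast_re]; positivity), ← integral_const_mul]
    exact (setIntegral_congr_fun measurableSet_Ioi fun y hy => hpt k y hy).symm
  · exact (by fun_prop : Measurable fun y : ℝ => (y : ℂ) ^ (σ - 1) *
      Complex.exp (-α * (y : ℂ) ^ 2) * ((-β * y) ^ k / (k.factorial : ℂ))).aestronglyMeasurable
  · filter_upwards [ae_restrict_mem measurableSet_Ioi] with y hy
    have hy : 0 < y := hy
    have h := norm_cpow_mul_cexp_quadratic hy (σ - 1) α 0
    simp only [zero_mul, add_zero, Complex.zero_re, Complex.sub_re, Complex.one_re] at h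
    rw [norm_mul, h, norm_div, norm_pow, norm_mul, norm_neg, Complex.norm_of_nonneg hy.le,
      Complex.norm_natCast]
  · rw [Real.exp_add, ← mul_assoc]
    refine HasSum.mul_left _ ?_
    rw [Real.exp_eq_exp_ℝ]
    exact NormedSpace.expSeries_div_hasSum_exp _
  · rw [Complex.exp_add, ← mul_assoc]
    refine HasSum.mul_left _ ?_
    rw [Complex.exp_eq_exp_ℂ]
    exact NormedSpace.expSeries_div_hasSum_exp _

/-- Splitting the series by the parity of `k`, each `Γ((σ+k)/2)` becomes a fixed Gamma value times a
Pochhammer symbol. -/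
theorem integral_cpow_mul_cexp_quadratic_eq_kummerF {σ α : ℂ} (hα : 0 < α.re) (hσ : 0 < σ.re)
    (β : ℂ) :
    ∫ y in Set.Ioi (0 : ℝ), (y : ℂ) ^ (σ - 1) * Complex.exp (-α * (y : ℂ) ^ 2 + -β * y) =
      1 / 2 * α ^ (-σ / 2 - 1 / 2) *
        (α ^ (1 / 2 : ℂ) * Complex.Gamma (σ / 2) * kummerF (σ / 2) (1 / 2) (β ^ 2 / (4 * α)) -
          β * Complex.Gamma ((σ + 1) / 2) *
            kummerF ((σ + 1) / 2) (3 / 2) (β ^ 2 / (4 * α))) := by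
  have hα0 : α ≠ 0 := by rintro rfl; simp at hα
  have h := hasSum_integral_cpow_mul_cexp_quadratic hα hσ β
  have hσ1 : 0 < (σ / 2).re := by simpa using hσ
  have hσ2 : 0 < ((σ + 1) / 2).re := by simp; linarith
  have h12 : 0 < (1 / 2 : ℂ).re := by norm_num
  have h32 : 0 < (3 / 2 : ℂ).re := by norm_num
  have hpow : ∀ j : ℕ, ∀ τ : ℂ, α ^ (-τ - j) = α ^ (-τ) / α ^ j := fun j τ => by
    rw [Complex.cpow_sub _ _ hα0, Complex.cpow_natCast]
  have hhalf : α ^ (-σ / 2 - 1 / 2) * α ^ (1 / 2 : ℂ) = α ^ (-(σ / 2)) := by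
    rw [← Complex.cpow_add _ _ hα0]
    ring_nf
  have hE : ∑' j : ℕ, (-β) ^ (2 * j) / ((2 * j).factorial : ℂ) *
      (1 / 2 * α ^ (-(σ + (2 * j : ℕ)) / 2) * Complex.Gamma ((σ + (2 * j : ℕ)) / 2)) =
      1 / 2 * α ^ (-(σ / 2)) * Complex.Gamma (σ / 2) *
        kummerF (σ / 2) (1 / 2) (β ^ 2 / (4 * α)) := by
    rw [kummerF_eq_tsum _ _ _ (Complex.ne_neg_natCast_of_re_pos h12), ← tsum_mul_left]
    refine tsum_congr fun j => ?_
    have e1 : -(σ + (2 * j : ℕ)) / 2 = -(σ / 2) - j := by push_cast; ring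
    have e2 : (σ + (2 * j : ℕ)) / 2 = σ / 2 + j := by push_cast; ring
    have hQ := ascPochhammer_eval_ne_zero_of_re_pos h12 j
    have hj : (j.factorial : ℂ) ≠ 0 := by exact_mod_cast j.factorial_ne_zero
    rw [e1, e2, hpow, Complex.Gamma_add_natCast_of_re_pos hσ1,
      factorial_two_mul_eq_ascPochhammer_half, pow_mul, neg_sq, div_pow, mul_pow]
    generalize (ascPochhammer ℂ j).eval (1 / 2 : ℂ) = Q at hQ ⊢
    field_simp
  have hO : ∑' j : ℕ, (-β) ^ (2 * j + 1) / ((2 * j + 1).factorial : ℂ) *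
      (1 / 2 * α ^ (-(σ + (2 * j + 1 : ℕ)) / 2) * Complex.Gamma ((σ + (2 * j + 1 : ℕ)) / 2)) =
      -(1 / 2 * α ^ (-((σ + 1) / 2)) * (β * Complex.Gamma ((σ + 1) / 2) *
        kummerF ((σ + 1) / 2) (3 / 2) (β ^ 2 / (4 * α)))) := by
    rw [kummerF_eq_tsum _ _ _ (Complex.ne_neg_natCast_of_re_pos h32), ← tsum_mul_left,
      ← tsum_mul_left, ← tsum_neg]
    refine tsum_congr fun j => ?_
    have e1 : -(σ + (2 * j + 1 : ℕ)) / 2 = -((σ + 1) / 2) - j := by push_cast; ring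
    have e2 : (σ + (2 * j + 1 : ℕ)) / 2 = (σ + 1) / 2 + j := by push_cast; ring
    have hQ := ascPochhammer_eval_ne_zero_of_re_pos h32 j
    have hj : (j.factorial : ℂ) ≠ 0 := by exact_mod_cast j.factorial_ne_zero
    rw [e1, e2, hpow, Complex.Gamma_add_natCast_of_re_pos hσ2,
      factorial_two_mul_add_one_eq_ascPochhammer_three_halves, pow_succ, pow_mul, neg_sq, div_pow,
      mul_pow]
    generalize (ascPochhammer ℂ j).eval (3 / 2 : ℂ) = Q at hQ ⊢
    field_simp
  have hexp : -((σ + 1) / 2) = -σ / 2 - 1 / 2 := by ring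
  set f : ℕ → ℂ := fun k => (-β) ^ k / (k.factorial : ℂ) *
    (1 / 2 * α ^ (-(σ + k) / 2) * Complex.Gamma ((σ + k) / 2)) with hf
  have he : Summable fun j => f (2 * j) := h.summable.comp_injective fun a b hab => by
    simpa using hab
  have ho : Summable fun j => f (2 * j + 1) := h.summable.comp_injective fun a b hab => by
    simpa using hab
  rw [← h.tsum_eq, ← tsum_even_add_odd he ho]
  simp only [hf]
  rw [hE, hO, ← hhalf, hexp]
  ring

/-! ### Majorizing the Bessel series -/

/-- Each step of the Gamma recurrence multiplies by `n + z + 1`, whose modulus is at least its real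
part, hence at least `n + 1`. -/
theorem Complex.norm_Gamma_add_natCast_ge {z : ℂ} (hz : 0 < z.re) (n : ℕ) :
    ‖Complex.Gamma (z + 1)‖ * n.factorial ≤ ‖Complex.Gamma (n + z + 1)‖ := by
  induction n with
  | zero => simp
  | succ n ih =>
    have hre : ((n : ℂ) + z + 1).re = n + z.re + 1 := by simp
    have h0 : (n : ℂ) + z + 1 ≠ 0 := by
      intro h
      rw [h, Complex.zero_re] at hre
      linarith [n.cast_nonneg (α := ℝ)]
    have e : ((n + 1 : ℕ) : ℂ) + z + 1 = (n + z + 1) + 1 := by push_cast; ring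
    have h1 : (n : ℝ) + 1 ≤ ‖(n : ℂ) + z + 1‖ := by
      refine le_trans ?_ (Complex.re_le_norm _)
      rw [hre]
      linarith
    rw [e, Complex.Gamma_add_one _ h0, norm_mul, Nat.factorial_succ]
    push_cast
    calc ‖Complex.Gamma (z + 1)‖ * (((n : ℝ) + 1) * n.factorial)
        = ((n : ℝ) + 1) * (‖Complex.Gamma (z + 1)‖ * n.factorial) := by ring
      _ ≤ _ := by gcongr

theorem factorial_two_mul_le (n : ℕ) :
    ((2 * n).factorial : ℝ) ≤ 4 ^ n * (n.factorial * n.factorial) := by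
  have h : (2 * n).factorial = n.centralBinom * (n.factorial * n.factorial) := by
    rw [Nat.centralBinom_eq_two_mul_choose, ← Nat.choose_mul_factorial_mul_factorial
      (by omega : n ≤ 2 * n), two_mul, Nat.add_sub_cancel, mul_assoc]
  rw [h]
  exact_mod_cast Nat.mul_le_mul_right _ n.centralBinom_le_four_pow

/-- Principal powers split here because `y / 2` is a positive real, so the logarithms add with no
branch correction. -/
theorem cpow_mul_ofReal_div_two {γ : ℂ} (hγ : γ ≠ 0) {y : ℝ} (hy : 0 < y) (lam : ℂ) (m : ℕ) :
    (γ * y / 2) ^ (2 * (m : ℂ) + lam) =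
      γ ^ (2 * m) * γ ^ lam * (2 : ℂ) ^ (-lam - 2 * (m : ℂ)) * (y : ℂ) ^ (2 * (m : ℂ) + lam) := by
  have hy2 : 0 < y / 2 := half_pos hy
  have e : γ * y / 2 = ((y / 2 : ℝ) : ℂ) * γ := by push_cast; ring
  have e2 : -lam - 2 * (m : ℂ) = -(2 * (m : ℂ) + lam) := by ring
  have e3 : γ ^ (2 * (m : ℂ) + lam) = γ ^ (2 * m) * γ ^ lam := by
    rw [Complex.cpow_add _ _ hγ, ← Complex.cpow_natCast]
    push_cast
    rfl
  have e4 : (((y / 2 : ℝ) : ℂ) * γ) ^ (2 * (m : ℂ) + lam) =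
      ((y / 2 : ℝ) : ℂ) ^ (2 * (m : ℂ) + lam) * γ ^ (2 * (m : ℂ) + lam) := by
    have h0 : ((y / 2 : ℝ) : ℂ) ≠ 0 := by exact_mod_cast hy2.ne'
    rw [Complex.cpow_def_of_ne_zero (mul_ne_zero h0 hγ), Complex.log_ofReal_mul hy2 hγ,
      Complex.cpow_def_of_ne_zero h0, Complex.cpow_def_of_ne_zero hγ, ← Complex.exp_add,
      Complex.ofReal_log hy2.le]
    ring_nf
  have e5 := Complex.div_cpow_ofReal_nonneg hy.le (by norm_num : (0 : ℝ) ≤ 2) (2 * (m : ℂ) + lam)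
  rw [e, e4, e3, e2, Complex.cpow_neg]
  push_cast at e5 ⊢
  rw [e5]
  ring

/-- Since `(2m)! ≤ 4^m m!²`, the denominators dominate those of the cosh series, whose sum is
explicit. -/
theorem norm_besselI_term_le {γ lam : ℂ} (hγ : γ ≠ 0) (hlam : 0 < lam.re) {y : ℝ} (hy : 0 < y)
    (m : ℕ) :
    ‖(γ * y / 2) ^ (2 * (m : ℂ) + lam) / ((m.factorial : ℂ) * Complex.Gamma (m + lam + 1))‖ ≤
      ‖γ ^ lam * (2 : ℂ) ^ (-lam)‖ / ‖Complex.Gamma (lam + 1)‖ * y ^ lam.re *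
        ((‖γ‖ * y) ^ (2 * m) / ((2 * m).factorial : ℝ)) := by
  have hG : 0 < ‖Complex.Gamma (lam + 1)‖ :=
    norm_pos_iff.2 (Complex.Gamma_ne_zero_of_re_pos (by simp; linarith))
  have hm : (0 : ℝ) < m.factorial := by exact_mod_cast m.factorial_pos
  have h2m : (0 : ℝ) < (2 * m).factorial := by exact_mod_cast (2 * m).factorial_pos
  have hGm := Complex.norm_Gamma_add_natCast_ge hlam m
  have e1 : (2 : ℂ) ^ (-lam - 2 * (m : ℂ)) = (2 : ℂ) ^ (-lam) / 4 ^ m := by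
    rw [Complex.cpow_sub _ _ two_ne_zero]
    congr 1
    rw [show (2 * (m : ℂ)) = ((2 * m : ℕ) : ℂ) by push_cast; rfl, Complex.cpow_natCast, pow_mul]
    norm_num
  have e2 : ‖(y : ℂ) ^ (2 * (m : ℂ) + lam)‖ = y ^ (2 * m) * y ^ lam.re := by
    rw [Complex.norm_cpow_eq_rpow_re_of_pos hy, ← Real.rpow_natCast, ← Real.rpow_add hy]
    congr 1
    simp
  rw [cpow_mul_ofReal_div_two hγ hy, e1, norm_div, norm_mul, e2]
  simp only [norm_mul, norm_div, norm_pow, Complex.norm_natCast, Complex.norm_ofNat]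
  have hden : ‖Complex.Gamma (lam + 1)‖ * ((2 * m).factorial : ℝ) / 4 ^ m ≤
      m.factorial * ‖Complex.Gamma (m + lam + 1)‖ := by
    rw [div_le_iff₀ (by positivity)]
    calc ‖Complex.Gamma (lam + 1)‖ * ((2 * m).factorial : ℝ)
        ≤ ‖Complex.Gamma (lam + 1)‖ * (4 ^ m * (m.factorial * m.factorial)) := by
          gcongr; exact factorial_two_mul_le m
      _ = m.factorial * (‖Complex.Gamma (lam + 1)‖ * m.factorial) * 4 ^ m := by ring
      _ ≤ _ := by gcongr
  calc _ ≤ ‖γ‖ ^ (2 * m) * ‖γ ^ lam‖ * (‖(2 : ℂ) ^ (-lam)‖ / 4 ^ m) *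
        (y ^ (2 * m) * y ^ lam.re) / (‖Complex.Gamma (lam + 1)‖ * ((2 * m).factorial : ℝ) / 4 ^ m) := by
        gcongr
    _ = _ := by
        rw [mul_pow]
        field_simp

theorem hasSum_besselI {γ lam : ℂ} (hγ : γ ≠ 0) (hlam : 0 < lam.re) {y : ℝ} (hy : 0 < y) :
    HasSum (fun m : ℕ => (γ * y / 2) ^ (2 * (m : ℂ) + lam) /
      ((m.factorial : ℂ) * Complex.Gamma (m + lam + 1))) (besselI lam (γ * y)) :=
  (Summable.of_norm_bounded ((Real.hasSum_cosh (‖γ‖ * y)).summable.mul_left _)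
    (norm_besselI_term_le hγ hlam hy)).hasSum

/-! ### Termwise integration -/

theorem mainTheorem4 (α β γ lam s : ℂ) (hα : 0 < α.re) (hβ : 0 < β.re) (hγ : 0 < γ.re)
    (hlam : 0 < lam.re) (hs : 1 < s.re) :
    IntegrableOn (fun y : ℝ => Complex.exp (-α * (y : ℂ) ^ 2 - β * y) * besselI lam (γ * y) *
      (y : ℂ) ^ (s - 1)) (Set.Ioi (0 : ℝ)) ∧
    HasSum (fun n : ℕ =>
      (-1) ^ n * γ ^ lam * (Complex.I * γ) ^ (2 * n) * (2 : ℂ) ^ (-lam - 2 * (n : ℂ) - 1) *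
          α ^ (-lam / 2 - (n : ℂ) - s / 2 - 1 / 2) /
        ((n.factorial : ℂ) * Complex.Gamma ((n : ℂ) + lam + 1)) *
      (α ^ (1 / 2 : ℂ) * Complex.Gamma ((1 / 2 : ℂ) * (2 * (n : ℂ) + s + lam)) *
          kummerF ((1 / 2 : ℂ) * (2 * (n : ℂ) + s + lam)) (1 / 2) (β ^ 2 / (4 * α)) -
        β * Complex.Gamma ((1 / 2 : ℂ) * (2 * (n : ℂ) + s + lam + 1)) *
          kummerF ((1 / 2 : ℂ) * (2 * (n : ℂ) + s + lam + 1)) (3 / 2) (β ^ 2 / (4 * α))))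
      (Upsilon α β γ lam s) := by
  have hγ0 : γ ≠ 0 := by rintro rfl; simp at hγ
  set p : ℝ := lam.re + (s.re - 1) with hp
  set C : ℝ := ‖γ ^ lam * (2 : ℂ) ^ (-lam)‖ / ‖Complex.Gamma (lam + 1)‖
  have hC0 : 0 ≤ C := by positivity
  -- Writing cosh as two exponentials reduces integrability of the majorant to the
  -- quadratic-exponential case.
  have hcosh : ∀ y : ℝ, y ^ p * Real.exp (-α.re * y ^ 2 + -β.re * y) * Real.cosh (‖γ‖ * y) =
      1 / 2 * (y ^ p * Real.exp (-α.re * y ^ 2 + (-β.re + ‖γ‖) * y) +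
        y ^ p * Real.exp (-α.re * y ^ 2 + (-β.re - ‖γ‖) * y)) := by
    intro y
    have h1 : -α.re * y ^ 2 + (-β.re + ‖γ‖) * y = (-α.re * y ^ 2 + -β.re * y) + ‖γ‖ * y := by ring
    have h2 : -α.re * y ^ 2 + (-β.re - ‖γ‖) * y = (-α.re * y ^ 2 + -β.re * y) + -(‖γ‖ * y) := by
      ring
    rw [h1, h2, Real.exp_add _ (‖γ‖ * y), Real.exp_add _ (-(‖γ‖ * y)), Real.cosh_eq]
    ring
  have hnorm : ∀ y : ℝ, 0 < y →
      ‖Complex.exp (-α * (y : ℂ) ^ 2 - β * y)‖ * ‖(y : ℂ) ^ (s - 1)‖ =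
        y ^ (s.re - 1) * Real.exp (-α.re * y ^ 2 + -β.re * y) := by
    intro y hy
    have h := norm_cpow_mul_cexp_quadratic hy (s - 1) α (-β)
    rw [norm_mul] at h
    have e : -α * (y : ℂ) ^ 2 - β * y = -α * (y : ℂ) ^ 2 + -β * y := by ring
    rw [mul_comm, e, h]
    simp
  obtain ⟨h1, h2⟩ := integrable_and_hasSum_integral_of_dominated
    (μ := volume.restrict (Set.Ioi (0 : ℝ)))
    (F := fun m y => Complex.exp (-α * (y : ℂ) ^ 2 - β * y) *
      ((γ * y / 2) ^ (2 * (m : ℂ) + lam) / ((m.factorial : ℂ) * Complex.Gamma (m + lam + 1))) *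
      (y : ℂ) ^ (s - 1))
    (f := fun y => Complex.exp (-α * (y : ℂ) ^ 2 - β * y) * besselI lam (γ * y) *
      (y : ℂ) ^ (s - 1))
    (fun m y => C * (y ^ p * Real.exp (-α.re * y ^ 2 + -β.re * y)) *
      ((‖γ‖ * y) ^ (2 * m) / ((2 * m).factorial : ℝ)))
    (fun y => C * (y ^ p * Real.exp (-α.re * y ^ 2 + -β.re * y)) * Real.cosh (‖γ‖ * y))
    (fun m => (by fun_prop : Measurable _).aestronglyMeasurable)
    (fun m => by
      filter_upwards [ae_restrict_mem measurableSet_Ioi] with y hy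
      have hy : 0 < y := hy
      rw [mul_right_comm, norm_mul, norm_mul, hnorm y hy]
      calc _ ≤ y ^ (s.re - 1) * Real.exp (-α.re * y ^ 2 + -β.re * y) *
            (C * y ^ lam.re * ((‖γ‖ * y) ^ (2 * m) / ((2 * m).factorial : ℝ))) := by
              gcongr
              exact norm_besselI_term_le hγ0 hlam hy m
        _ = _ := by
              rw [hp, Real.rpow_add hy]
              ring)
    (Filter.Eventually.of_forall fun y => (Real.hasSum_cosh (‖γ‖ * y)).mul_left _)
    (by
      simp_rw [mul_assoc C, hcosh]
      exact (((integrableOn_rpow_mul_exp_quadratic hα (by linarith) _).add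
        (integrableOn_rpow_mul_exp_quadratic hα (by linarith) _)).const_mul _).const_mul _)
    (by
      filter_upwards [ae_restrict_mem measurableSet_Ioi] with y hy
      exact ((hasSum_besselI hγ0 hlam hy).mul_left _).mul_right _)
  refine ⟨h1, ?_⟩
  rw [Upsilon]
  convert! h2 using 2 with n
  have hσ : 0 < (2 * (n : ℂ) + s + lam).re := by
    simp only [Complex.add_re, Complex.mul_re, Complex.re_ofNat, Complex.im_ofNat,
      Complex.natCast_re, zero_mul, sub_zero]
    positivity
  have hI := integral_cpow_mul_cexp_quadratic_eq_kummerF hα hσ β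
  have hint : ∫ y in Set.Ioi (0 : ℝ), Complex.exp (-α * (y : ℂ) ^ 2 - β * y) *
      ((γ * y / 2) ^ (2 * (n : ℂ) + lam) / ((n.factorial : ℂ) * Complex.Gamma (n + lam + 1))) *
      (y : ℂ) ^ (s - 1) = γ ^ (2 * n) * γ ^ lam * (2 : ℂ) ^ (-lam - 2 * (n : ℂ)) /
        ((n.factorial : ℂ) * Complex.Gamma (n + lam + 1)) *
        ∫ y in Set.Ioi (0 : ℝ), (y : ℂ) ^ ((2 * (n : ℂ) + s + lam) - 1) *
          Complex.exp (-α * (y : ℂ) ^ 2 + -β * y) := by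
    rw [← integral_const_mul]
    refine setIntegral_congr_fun measurableSet_Ioi fun y hy => ?_
    have hy : 0 < y := hy
    have hadd : (y : ℂ) ^ ((2 * (n : ℂ) + s + lam) - 1) =
        (y : ℂ) ^ (2 * (n : ℂ) + lam) * (y : ℂ) ^ (s - 1) := by
      rw [← Complex.cpow_add _ _ (by exact_mod_cast hy.ne')]
      ring_nf
    have e : -α * (y : ℂ) ^ 2 - β * y = -α * (y : ℂ) ^ 2 + -β * y := by ring
    rw [cpow_mul_ofReal_div_two hγ0 hy, hadd, e]
    ring
  -- The signs `(-1)^n` and `i^(2n)` cancel.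
  have hsign : (-1 : ℂ) ^ n * (Complex.I * γ) ^ (2 * n) = γ ^ (2 * n) := by
    rw [pow_mul, pow_mul, ← mul_pow, mul_pow Complex.I, Complex.I_sq]
    simp
  have htwo : (2 : ℂ) ^ (-lam - 2 * (n : ℂ) - 1) = (2 : ℂ) ^ (-lam - 2 * (n : ℂ)) * (1 / 2) := by
    rw [Complex.cpow_sub _ _ two_ne_zero, Complex.cpow_one, div_eq_mul_one_div]
  have a1 : -(2 * (n : ℂ) + s + lam) / 2 - 1 / 2 = -lam / 2 - (n : ℂ) - s / 2 - 1 / 2 := by ring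
  have a2 : (2 * (n : ℂ) + s + lam) / 2 = 1 / 2 * (2 * (n : ℂ) + s + lam) := by ring
  have a3 : (2 * (n : ℂ) + s + lam + 1) / 2 = 1 / 2 * (2 * (n : ℂ) + s + lam + 1) := by ring
  rw [hint, hI, a1, a2, a3, htwo, ← hsign]
  ring
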